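/- Let $k$ be a commutative ring and let $S$ be a commutative $k$-algebra which is formally smooth and essentially of finite presentation over $k$ (that is, a localization of a finitely presented commutative $k$-algebra). Let $x_1,\dots,x_n\in S$ be elements such that $dx_1,\dots,dx_n$ form a basis of the $S$-module $\Omega^1_{S|k}$ of Kähler differentials. Let $D_{S|k}=\bigcup_{m\ge 0}D^m_{S|k}\subseteq \operatorname{End}_k(S)$ be the ring of $k$-linear differential operators on $S$, where $D^0_{S|k}=S$ (acting by multiplication) and $D^{m+1}_{S|k}=\{\xi\in\operatorname{End}_k(S) : [\xi,f]\in D^m_{S|k}\text{ for all } f\in S\}$. Then for every $\alpha\in\mathbb N_0^n$ there is a unique $\partial^{[\alpha]}\in D_{S|k}$ such that $$\partial^{[\alpha]}(x^\beta)=\prod_{i=1}^n\binom{\beta_i}{\alpha_i}\,x^{\beta-\alpha}\quad\text{for all }\beta\in\mathbb N_0^n,$$ where $x^\beta=x_1^{\beta_1}\cdots x_n^{\beta_n}$ and the right-hand side is read as $0$ unless $\alpha\le\beta$ componentwise. Moreover, there is a unique ring anti-automorphism $\Phi$ of $D_{S|k}$ (a bijective additive map with $\Phi(1)=1$ and $\Phi(\xi\eta)=\Phi(\eta)\Phi(\xi)$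 for all $\xi,\eta\in D_{S|k}$) such that $\Phi\circ\Phi=\mathrm{id}$, $\Phi(f)=f$ for all $f\in S$, and $\Phi(\partial^{[\alpha]})=(-1)^{|\alpha|}\partial^{[\alpha]}$ for all $\alpha\in\mathbb N_0^n$, where $|\alpha|=\alpha_1+\cdots+\alpha_n$. -/

import Mathlib

open scoped KaehlerDifferential

universe u v

/-- `S` is essentially of finite presentation over `k`: it is a localization, at some
multiplicative subset, of a finitely presented commutative `k`-algebra `A`. (Every finitely
presented `k`-algebra is isomorphic to a quotient of a polynomial ring in finitely many variables
over `k`, which lies in the universe of `k`, so the universe of `A` is no restriction.) -/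
def IsEssFinitePresentation (k : Type u) (S : Type v) [CommRing k] [CommRing S] [Algebra k S] :
    Prop :=
  ∃ (A : Type u) (_ : CommRing A) (_ : Algebra k A) (_ : Algebra A S) (W : Submonoid A),
    IsScalarTower k A S ∧ Algebra.FinitePresentation k A ∧ IsLocalization W S

/-- The `k`-module `D^m_{S|k}` of `k`-linear differential operators of order at most `m` on `S`:
`D^0_{S|k}` consists of the multiplications by elements of `S`, and `ξ` belongs to
`D^{m+1}_{S|k}` when all the commutators `[ξ, f]`, `f ∈ S`, belong to `D^m_{S|k}`. -/
def diffOpOrder (k : Type u) (S : Type v) [CommRing k] [CommRing S] [Algebra k S] :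
    ℕ → Submodule k (Module.End k S)
  | 0 => LinearMap.range (LinearMap.mul k S)
  | m + 1 =>
    { carrier := {ξ | ∀ f : S,
        ξ * LinearMap.mulLeft k f - LinearMap.mulLeft k f * ξ ∈ diffOpOrder k S m}
      zero_mem' := fun f => by simp
      add_mem' := fun {a b} ha hb f => by
        have h := Submodule.add_mem _ (ha f) (hb f)
        have e : (a + b) * LinearMap.mulLeft k f - LinearMap.mulLeft k f * (a + b) =
          (a * LinearMap.mulLeft k f - LinearMap.mulLeft k f * a) +
          (b * LinearMap.mulLeft k f - LinearMap.mulLeft k f * b) := by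
          rw [add_mul, mul_add]; abel
        rw [e]; exact h
      smul_mem' := fun c a ha f => by
        have h := Submodule.smul_mem _ c (ha f)
        rw [smul_sub] at h
        rw [smul_mul_assoc, mul_smul_comm]; exact h }

section DiffOps

variable (k : Type u) (S : Type v) [CommRing k] [CommRing S] [Algebra k S]

theorem mulLeft_mem_diffOpOrder_zero (f : S) : LinearMap.mulLeft k f ∈ diffOpOrder k S 0 :=
  ⟨f, rfl⟩

theorem mem_diffOpOrder_succ (m : ℕ) (ξ : Module.End k S) :
    ξ ∈ diffOpOrder k S (m + 1) ↔ ∀ f : S,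
      ξ * LinearMap.mulLeft k f - LinearMap.mulLeft k f * ξ ∈ diffOpOrder k S m :=
  Iff.rfl

theorem mulLeft_commutator (f g : S) :
    LinearMap.mulLeft k f * LinearMap.mulLeft k g -
      LinearMap.mulLeft k g * LinearMap.mulLeft k f = 0 := by
  ext s
  simp [mul_left_comm]

theorem diffOpOrder_le_succ (m : ℕ) : diffOpOrder k S m ≤ diffOpOrder k S (m + 1) := by
  induction m with
  | zero =>
    rintro _ ⟨g, rfl⟩ f
    have h : LinearMap.mul k S g * LinearMap.mulLeft k f -
        LinearMap.mulLeft k f * LinearMap.mul k S g = 0 := mulLeft_commutator k S g f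
    rw [h]
    exact Submodule.zero_mem _
  | succ m ih => exact fun ξ hξ f => ih (hξ f)

theorem diffOpOrder_mono : Monotone (diffOpOrder k S) :=
  monotone_nat_of_le_succ (diffOpOrder_le_succ k S)

theorem mul_mem_diffOpOrder (N : ℕ) : ∀ (m l : ℕ), m + l = N → ∀ ξ ∈ diffOpOrder k S m,
    ∀ η ∈ diffOpOrder k S l, ξ * η ∈ diffOpOrder k S N := by
  induction N with
  | zero =>
    intro m l h ξ hξ η hη
    obtain rfl : m = 0 := by omega
    obtain rfl : l = 0 := by omega
    obtain ⟨a, rfl⟩ := hξ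
    obtain ⟨b, rfl⟩ := hη
    refine ⟨a * b, ?_⟩
    ext s
    simp [mul_assoc]
  | succ N ih =>
    intro m l h ξ hξ η hη f
    have e : ξ * η * LinearMap.mulLeft k f - LinearMap.mulLeft k f * (ξ * η) =
        ξ * (η * LinearMap.mulLeft k f - LinearMap.mulLeft k f * η) +
        (ξ * LinearMap.mulLeft k f - LinearMap.mulLeft k f * ξ) * η := by
      rw [mul_sub, sub_mul]
      simp only [mul_assoc]
      abel
    rw [e]
    refine Submodule.add_mem _ ?_ ?_
    · cases l with
      | zero =>
        obtain ⟨b, rfl⟩ := hη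
        have h0 : LinearMap.mul k S b * LinearMap.mulLeft k f -
            LinearMap.mulLeft k f * LinearMap.mul k S b = 0 := mulLeft_commutator k S b f
        rw [h0, mul_zero]
        exact Submodule.zero_mem _
      | succ l => exact ih m l (by omega) ξ hξ _ (hη f)
    · cases m with
      | zero =>
        obtain ⟨a, rfl⟩ := hξ
        have h0 : LinearMap.mul k S a * LinearMap.mulLeft k f -
            LinearMap.mulLeft k f * LinearMap.mul k S a = 0 := mulLeft_commutator k S a f
        rw [h0, zero_mul]
        exact Submodule.zero_mem _
      | succ m => exact ih m l (by omega) _ (hξ f) η hη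

/-- The ring `D_{S|k} = ⋃ₘ D^m_{S|k}` of `k`-linear differential operators on `S`, as a
`k`-subalgebra of `End_k(S)`. -/
def diffOps : Subalgebra k (Module.End k S) where
  carrier := {ξ | ∃ m : ℕ, ξ ∈ diffOpOrder k S m}
  mul_mem' := by
    rintro a b ⟨m, hm⟩ ⟨l, hl⟩
    exact ⟨m + l, mul_mem_diffOpOrder k S (m + l) m l rfl a hm b hl⟩
  add_mem' := by
    rintro a b ⟨m, hm⟩ ⟨l, hl⟩
    exact ⟨max m l, Submodule.add_mem _ (diffOpOrder_mono k S (le_max_left m l) hm)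
      (diffOpOrder_mono k S (le_max_right m l) hl)⟩
  algebraMap_mem' := fun c => ⟨0, algebraMap k S c, by
    ext s
    simp [Algebra.smul_def]⟩

end DiffOps

/-- The element `f ∈ S`, seen as the differential operator `g ↦ f * g`. -/
def mulDiffOp (k : Type u) {S : Type v} [CommRing k] [CommRing S] [Algebra k S] (f : S) :
    diffOps k S :=
  ⟨LinearMap.mulLeft k f, 0, mulLeft_mem_diffOpOrder_zero k S f⟩

/-- The property which characterizes the divided power operator `∂^{[α]}` with respect to
`x₁, …, xₙ`: for every multi-exponent `β` it maps `x^β` to `(β! / (α! (β - α)!)) x^{β - α}`.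
The coefficient is the product of the binomial coefficients `(βᵢ choose αᵢ)`; it is zero unless
`α ≤ β`, so that the truncated subtraction is harmless. -/
def IsDividedPowerOp {k : Type u} {S : Type v} [CommRing k] [CommRing S] [Algebra k S] {n : ℕ}
    (x : Fin n → S) (α : Fin n → ℕ) (ξ : diffOps k S) : Prop :=
  ∀ β : Fin n → ℕ, (ξ : Module.End k S) (∏ i, x i ^ β i) =
    ((∏ i, (β i).choose (α i) : ℕ) : S) * ∏ i, x i ^ (β i - α i)

/-! The coordinates make `S` formally étale over `k[X₁,…,Xₙ]`, so the substitution `Xᵢ ↦ xᵢ + tᵢ`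
lifts to a Taylor homomorphism `T : S → S[[t]]` reducing to the identity at `t = 0`
(`exists_taylorHom`). The coefficient of `t^α` in `T s` is `∂^[α] s`: multiplicativity of `T` gives
the Leibniz rule, hence the finite order, and the binomial theorem gives the values on monomials. An
operator of order at most `m` is determined by its values on monomials of degree at most `m`
(`eq_zero_of_forall_coordMonomial`), which gives uniqueness and the composition rule.

The matrix of the `∂^[α]` on monomials is unitriangular, so every operator is uniquely a finite sum
`∑ f_α ∂^[α]`. Hence `f ∂^[α] ↦ (-1)^|α| ∂^[α] f` defines an additive map. It reverses products
because the Leibniz rule can be inverted with alternating signs (`mulDiffOp_mul_taylorDiffOp`).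
Being an involution, and its uniqueness, are then checked on the operators `f ∂^[α]`. -/

/-! ### Formal smoothness over the coordinate ring and the Taylor homomorphism. -/

section TaylorHom

/-- Along a formally smooth ring homomorphism `P → S`, a compatible homomorphism from `P` to an
adically complete ring `B` over `S` extends to a section `S → B`. -/
theorem exists_section_of_isAdicComplete {P S B : Type*} [CommRing P] [CommRing S] [CommRing B]
    [Algebra P S] [Algebra.FormallySmooth P S] (g : P →+* B) (q : B →+* S)
    (hq : Function.Surjective q) (hc : q.comp g = algebraMap P S)
    (I : Ideal B) (hI : RingHom.ker q = I) [IsAdicComplete I B] :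
    ∃ T : S →+* B, q.comp T = RingHom.id S ∧ T.comp (algebraMap P S) = g := by
  subst hI
  let _ := g.toAlgebra
  let q' : B →ₐ[P] S := { q with commutes' := fun r => RingHom.congr_fun hc r }
  have hq' : Function.Surjective q' := hq
  obtain ⟨T, hT⟩ := Algebra.FormallySmooth.exists_mkₐ_comp_eq_of_isAdicComplete (R := P)
    (I := RingHom.ker q) (Ideal.quotientKerAlgEquivOfSurjective hq').symm.toAlgHom
  refine ⟨T, ?_, ?_⟩
  · ext s
    have h := congr(Ideal.quotientKerAlgEquivOfSurjective hq' ($hT s))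
    simpa using! h
  · ext r
    exact T.commutes r

/-- If the differentials of a family `x` form a basis of `Ω[S⁄k]` and `S` is formally smooth
over `k`, then `S` is formally smooth over the polynomial ring with variables mapped to `x`. -/
theorem formallySmooth_mvPolynomial {k S : Type*} [CommRing k] [CommRing S] [Algebra k S]
    [Algebra.FormallySmooth k S] {σ : Type*} (x : σ → S) [Algebra (MvPolynomial σ k) S]
    [IsScalarTower k (MvPolynomial σ k) S]
    (hx : ∀ i, algebraMap (MvPolynomial σ k) S (MvPolynomial.X i) = x i)
    (hli : LinearIndependent S fun i => KaehlerDifferential.D k S (x i))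
    (hspan : Submodule.span S (Set.range fun i => KaehlerDifferential.D k S (x i)) = ⊤) :
    Algebra.FormallySmooth (MvPolynomial σ k) S := by
  have hbij : Function.Bijective (KaehlerDifferential.mapBaseChange k (MvPolynomial σ k) S) := by
    let b := (KaehlerDifferential.mvPolynomialBasis k σ).baseChange S
    let c := Module.Basis.mk hli hspan.ge
    have h : KaehlerDifferential.mapBaseChange k (MvPolynomial σ k) S =
        (b.equiv c (Equiv.refl σ)).toLinearMap := by
      refine b.ext fun i => ?_
      rw [LinearEquiv.coe_coe, Module.Basis.equiv_apply]
      simp [b, c, hx, Module.Basis.baseChange_apply]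
    rw [h]
    exact (b.equiv c (Equiv.refl σ)).bijective
  have h0 : Subsingleton Ω[S⁄MvPolynomial σ k] := by
    refine subsingleton_of_forall_eq 0 fun y => ?_
    obtain ⟨z, rfl⟩ := KaehlerDifferential.map_surjective k (MvPolynomial σ k) S y
    exact (KaehlerDifferential.exact_mapBaseChange_map k (MvPolynomial σ k) S z).mpr (hbij.2 z)
  -- Formal smoothness over `k` kills `H₁` of `S` over `k`, so `δ` is injective; its image lies in
  -- the kernel of `mapBaseChange`, which is zero.
  have h1 : Subsingleton (Algebra.H1Cotangent (MvPolynomial σ k) S) := by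
    refine subsingleton_of_forall_eq 0 fun y => ?_
    have hy : Algebra.H1Cotangent.δ k (MvPolynomial σ k) S y = 0 := by
      apply hbij.1
      rw [map_zero]
      exact (Algebra.H1Cotangent.exact_δ_mapBaseChange k (MvPolynomial σ k) S _).mpr ⟨y, rfl⟩
    obtain ⟨z, rfl⟩ := (Algebra.H1Cotangent.exact_map_δ k (MvPolynomial σ k) S y).mp hy
    rw [Subsingleton.elim z 0, map_zero]
  exact ⟨inferInstance, h1⟩

-- Each nonconstant monomial is charged to one variable dividing it, and the terms are grouped by
-- that variable. This identifies the kernel with the ideal for which adic completeness is known.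
open MvPowerSeries in
theorem MvPowerSeries.ker_constantCoeff {σ R : Type*} [Finite σ] [CommRing R] :
    RingHom.ker (MvPowerSeries.constantCoeff (σ := σ) (R := R)) =
      Ideal.span (Set.range MvPowerSeries.X) := by
  classical
  have := Fintype.ofFinite σ
  refine le_antisymm (fun f hf => ?_) ?_
  · have hc : ∀ d : σ →₀ ℕ, ∃ s : Finset σ, s.card ≤ 1 ∧ (∀ i ∈ s, d i ≠ 0) ∧
        (d ≠ 0 → s.Nonempty) := by
      intro d
      by_cases hd : d = 0
      · exact ⟨∅, by simp, by simp, by simp [hd]⟩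
      · obtain ⟨i, hi⟩ := Finsupp.ne_iff.mp hd
        exact ⟨{i}, by simp, by simpa using hi, by simp⟩
    choose c hc1 hc2 hc3 using hc
    let g : σ → MvPowerSeries σ R := fun i d =>
      if i ∈ c (d + Finsupp.single i 1) then coeff (d + Finsupp.single i 1) f else 0
    have hg : ∀ i d, coeff d (X i * g i) = if i ∈ c d then coeff d f else 0 := by
      intro i d
      rw [X, coeff_monomial_mul, one_mul]
      by_cases hi : Finsupp.single i 1 ≤ d
      · rw [if_pos hi]
        change (if i ∈ c (d - Finsupp.single i 1 + Finsupp.single i 1) then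
          coeff (d - Finsupp.single i 1 + Finsupp.single i 1) f else 0) = _
        rw [tsub_add_cancel_of_le hi]
      · rw [if_neg hi, if_neg fun h => hi ?_]
        rw [Finsupp.single_le_iff]
        exact Nat.one_le_iff_ne_zero.mpr (hc2 d i h)
    have hf' : f = ∑ i, X i * g i := by
      ext d
      rw [map_sum]
      simp only [hg]
      rw [Finset.sum_ite_mem, Finset.univ_inter, Finset.sum_const]
      by_cases hd : d = 0
      · subst hd
        rw [coeff_zero_eq_constantCoeff_apply, RingHom.mem_ker.mp hf, smul_zero]
      · rw [le_antisymm (hc1 d) (Finset.card_pos.mpr (hc3 d hd)), one_smul]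
    rw [hf']
    exact Ideal.sum_mem _ fun i _ =>
      Ideal.mul_mem_right _ _ (Ideal.subset_span ⟨i, rfl⟩)
  · rw [Ideal.span_le]
    rintro _ ⟨i, rfl⟩
    exact RingHom.mem_ker.mpr (constantCoeff_X i)

/-- The Taylor expansion along a family `x` whose differentials form a basis. -/
theorem exists_taylorHom {k S : Type*} [CommRing k] [CommRing S] [Algebra k S]
    [Algebra.FormallySmooth k S] {σ : Type*} [Finite σ] (x : σ → S)
    (hli : LinearIndependent S fun i => KaehlerDifferential.D k S (x i))
    (hspan : Submodule.span S (Set.range fun i => KaehlerDifferential.D k S (x i)) = ⊤) :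
    ∃ T : S →ₐ[k] MvPowerSeries σ S, (∀ s, MvPowerSeries.constantCoeff (T s) = s) ∧
      ∀ i, T (x i) = MvPowerSeries.C (x i) + MvPowerSeries.X i := by
  let _ : Algebra (MvPolynomial σ k) S := (MvPolynomial.aeval (R := k) x).toAlgebra
  have : IsScalarTower k (MvPolynomial σ k) S := .of_algebraMap_eq' (by
    ext c; exact ((MvPolynomial.aeval (R := k) x).commutes c).symm)
  have hx : ∀ i, algebraMap (MvPolynomial σ k) S (MvPolynomial.X i) = x i := fun i =>
    MvPolynomial.aeval_X x i
  have := formallySmooth_mvPolynomial x hx hli hspan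
  let g : MvPolynomial σ k →ₐ[k] MvPowerSeries σ S :=
    MvPolynomial.aeval fun i => MvPowerSeries.C (x i) + MvPowerSeries.X i
  obtain ⟨T, hT, hg⟩ := exists_section_of_isAdicComplete (P := MvPolynomial σ k) (S := S)
    (g : MvPolynomial σ k →+* MvPowerSeries σ S) MvPowerSeries.constantCoeff
    (fun s => ⟨MvPowerSeries.C s, by simp⟩)
    (by
      ext c
      · simp [g, IsScalarTower.algebraMap_apply k (MvPolynomial σ k) S,
          MvPowerSeries.algebraMap_apply]
      · simp [g, hx])
    _ MvPowerSeries.ker_constantCoeff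
  refine ⟨{ T with commutes' := fun c => ?_ }, fun s => RingHom.congr_fun hT s, fun i => ?_⟩
  · have h := RingHom.congr_fun hg (algebraMap k _ c)
    rw [RingHom.comp_apply, ← IsScalarTower.algebraMap_apply] at h
    exact h.trans (g.commutes c)
  · have h := RingHom.congr_fun hg (MvPolynomial.X i)
    rw [RingHom.comp_apply, hx] at h
    exact h.trans (MvPolynomial.aeval_X _ i)

end TaylorHom

/-! ### Differential operators are determined by their values on monomials. -/

section Uniqueness

variable {k S : Type*} [CommRing k] [CommRing S] [Algebra k S] {σ : Type*} {x : σ → S}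

/-- A derivation vanishing on elements whose differentials generate `Ω[S⁄k]` is zero. -/
theorem Derivation.eq_zero_of_span_eq_top
    (hspan : Submodule.span S (Set.range fun i => KaehlerDifferential.D k S (x i)) = ⊤)
    (δ : Derivation k S S) (h : ∀ i, δ (x i) = 0) : δ = 0 := by
  have h0 : δ.liftKaehlerDifferential = 0 := by
    refine LinearMap.ext_on_range (v := fun i => KaehlerDifferential.D k S (x i)) hspan fun i => ?_
    simp [h]
  rw [← δ.liftKaehlerDifferential_comp, h0]
  ext
  simp

/-- A differential operator commuting with coordinates `x` is a multiplication operator. -/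
theorem mem_diffOpOrder_zero_of_commute
    (hspan : Submodule.span S (Set.range fun i => KaehlerDifferential.D k S (x i)) = ⊤) (m : ℕ) :
    ∀ ξ ∈ diffOpOrder k S m,
      (∀ i, ξ * LinearMap.mulLeft k (x i) = LinearMap.mulLeft k (x i) * ξ) →
      ξ ∈ diffOpOrder k S 0 := by
  induction m with
  | zero => exact fun ξ hξ _ => hξ
  | succ m ih =>
    intro ξ hξ hc
    -- `[ξ, f]` again commutes with every `xᵢ`, so by induction it is a multiplication.
    have hη : ∀ f : S, ∃ g : S, ∀ s, ξ (f * s) - f * ξ s = g * s := by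
      intro f
      obtain ⟨g, hg⟩ := ih _ (hξ f) fun i => by
        have e : LinearMap.mulLeft k f * LinearMap.mulLeft k (x i) =
          LinearMap.mulLeft k (x i) * LinearMap.mulLeft k f :=
          sub_eq_zero.mp (mulLeft_commutator k S f (x i))
        rw [sub_mul, mul_sub, mul_assoc, mul_assoc, e, hc, ← mul_assoc, hc, ← mul_assoc,
          ← mul_assoc, e]
        simp only [mul_assoc]
      exact ⟨g, fun s => (LinearMap.congr_fun hg s).symm⟩
    have hη' : ∀ f s : S, ξ (f * s) - f * ξ s = (ξ f - f * ξ 1) * s := by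
      intro f s
      obtain ⟨g, hg⟩ := hη f
      have h1 := hg 1
      rw [mul_one, mul_one] at h1
      rw [hg s, h1]
    -- Consequently `ξ` minus multiplication by `ξ 1` is a derivation, and it kills every `xᵢ`.
    let δ : Derivation k S S := Derivation.mk' (ξ - LinearMap.mulRight k (ξ 1)) fun f g => by
      have h := hη' f g
      simp only [LinearMap.sub_apply, LinearMap.mulRight_apply, smul_eq_mul]
      linear_combination h
    have hδ : δ = 0 := δ.eq_zero_of_span_eq_top hspan fun i => by
      have h := LinearMap.congr_fun (hc i) 1
      simp only [Module.End.mul_apply, LinearMap.mulLeft_apply, mul_one] at h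
      simp [δ, h]
    refine ⟨ξ 1, LinearMap.ext fun f => ?_⟩
    have h : ξ f - f * ξ 1 = 0 := congr($hδ f)
    rw [LinearMap.mul_apply', mul_comm, sub_eq_zero.mp h]

variable [Fintype σ]

/-- The monomial `x^β`. -/
def coordMonomial (x : σ → S) (β : σ →₀ ℕ) : S := ∏ i, x i ^ β i

theorem coordMonomial_zero : coordMonomial x 0 = 1 := by simp [coordMonomial]

theorem coordMonomial_single_add (i : σ) (β : σ →₀ ℕ) :
    coordMonomial x (Finsupp.single i 1 + β) = x i * coordMonomial x β := by
  classical
  simp only [coordMonomial, Finsupp.add_apply, pow_add, Finset.prod_mul_distrib]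
  congr 1
  rw [Finset.prod_eq_single i]
  · simp
  · intro j _ hj
    simp [Finsupp.single_eq_of_ne hj]
  · simp

/-- A differential operator of order at most `m` killing the monomials of degree at most `m` in
the coordinates is zero. -/
theorem eq_zero_of_forall_coordMonomial
    (hspan : Submodule.span S (Set.range fun i => KaehlerDifferential.D k S (x i)) = ⊤) (m : ℕ) :
    ∀ ξ ∈ diffOpOrder k S m, (∀ β : σ →₀ ℕ, β.degree ≤ m → ξ (coordMonomial x β) = 0) → ξ = 0 := by
  induction m with
  | zero =>
    rintro _ ⟨a, rfl⟩ h
    have h0 := h 0 (by simp)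
    rw [coordMonomial_zero, LinearMap.mul_apply', mul_one] at h0
    rw [h0, map_zero]
  | succ m ih =>
    intro ξ hξ h
    -- `[ξ, xᵢ]` has order at most `m` and involves `ξ` only on monomials of degree at most `m + 1`.
    have hc : ∀ i, ξ * LinearMap.mulLeft k (x i) - LinearMap.mulLeft k (x i) * ξ = 0 := by
      intro i
      refine ih _ (hξ (x i)) fun β hβ => ?_
      simp only [LinearMap.sub_apply, Module.End.mul_apply, LinearMap.mulLeft_apply]
      rw [← coordMonomial_single_add, h, h _ (by omega), mul_zero, sub_zero]
      rw [map_add, Finsupp.degree_single]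
      omega
    obtain ⟨a, rfl⟩ := mem_diffOpOrder_zero_of_commute hspan _ ξ hξ fun i => sub_eq_zero.mp (hc i)
    have h0 := h 0 (by simp)
    rw [coordMonomial_zero, LinearMap.mul_apply', mul_one] at h0
    rw [h0, map_zero]

/-- Differential operators are determined by their values on monomials in the coordinates. -/
theorem diffOps_ext_coordMonomial
    (hspan : Submodule.span S (Set.range fun i => KaehlerDifferential.D k S (x i)) = ⊤)
    {ξ η : diffOps k S}
    (h : ∀ β : σ →₀ ℕ, (ξ : Module.End k S) (coordMonomial x β) =
      (η : Module.End k S) (coordMonomial x β)) : ξ = η := by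
  obtain ⟨m, hm⟩ := (ξ - η).2
  rw [← sub_eq_zero]
  refine Subtype.ext (eq_zero_of_forall_coordMonomial hspan m _ hm fun β _ => ?_)
  exact sub_eq_zero.mpr (h β)

end Uniqueness

/-! ### Taylor coefficients as differential operators. -/

section TaylorOp

variable {k S : Type*} [CommRing k] [CommRing S] [Algebra k S] {σ : Type*}

open MvPowerSeries

/-- The operator sending `s` to the coefficient of `t^α` in its Taylor expansion `T s`. -/
noncomputable def taylorOp (T : S →ₐ[k] MvPowerSeries σ S) (α : σ →₀ ℕ) : Module.End k S where
  toFun s := coeff α (T s)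
  map_add' := by simp
  map_smul' := by simp

theorem taylorOp_apply (T : S →ₐ[k] MvPowerSeries σ S) (α : σ →₀ ℕ) (s : S) :
    taylorOp T α s = coeff α (T s) := rfl

theorem taylorOp_mul [DecidableEq σ] (T : S →ₐ[k] MvPowerSeries σ S) (α : σ →₀ ℕ) (s t : S) :
    taylorOp T α (s * t) =
      ∑ p ∈ Finset.HasAntidiagonal.antidiagonal α, taylorOp T p.1 s * taylorOp T p.2 t := by
  simp only [taylorOp_apply, map_mul, coeff_mul]

theorem taylorOp_zero_apply {T : S →ₐ[k] MvPowerSeries σ S}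
    (hT : ∀ s, constantCoeff (T s) = s) (s : S) : taylorOp T 0 s = s := hT s

theorem taylorOp_mem_diffOpOrder {T : S →ₐ[k] MvPowerSeries σ S}
    (hT : ∀ s, constantCoeff (T s) = s) (m : ℕ) :
    ∀ α : σ →₀ ℕ, α.degree ≤ m → taylorOp T α ∈ diffOpOrder k S m := by
  classical
  induction m with
  | zero =>
    intro α hα
    obtain rfl : α = 0 := (Finsupp.degree_eq_zero_iff α).mp (by omega)
    exact ⟨1, by ext s; simp [taylorOp_zero_apply hT]⟩
  | succ m ih =>
    intro α hα f
    -- The Leibniz term at `(0, α)` cancels against `f ∂^[α]`; every remaining term has a `∂` of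
    -- smaller degree.
    have e : taylorOp T α * LinearMap.mulLeft k f - LinearMap.mulLeft k f * taylorOp T α =
        ∑ p ∈ (Finset.HasAntidiagonal.antidiagonal α).erase (0, α),
          LinearMap.mulLeft k (taylorOp T p.1 f) * taylorOp T p.2 := by
      ext s
      simp only [LinearMap.sub_apply, Module.End.mul_apply, LinearMap.mulLeft_apply,
        LinearMap.sum_apply, taylorOp_mul]
      rw [← Finset.add_sum_erase _ _ (show (0, α) ∈ Finset.HasAntidiagonal.antidiagonal α by simp),
        taylorOp_zero_apply hT, add_sub_cancel_left]
    rw [e]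
    refine Submodule.sum_mem _ fun p hp => ?_
    obtain ⟨hp0, hp⟩ := Finset.mem_erase.mp hp
    rw [Finset.HasAntidiagonal.mem_antidiagonal] at hp
    have h1 : p.1.degree ≠ 0 := fun h => hp0 <| by
      rw [Finsupp.degree_eq_zero_iff] at h
      rw [h, zero_add] at hp
      exact Prod.ext h hp
    have h2 : p.1.degree + p.2.degree = α.degree := by rw [← map_add, hp]
    exact mul_mem_diffOpOrder k S m 0 m (zero_add m) _ (mulLeft_mem_diffOpOrder_zero k S _) _
      (ih _ (by omega))

variable [Fintype σ]

/-- The product of the binomial coefficients `(βᵢ choose αᵢ)`. -/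
def multiChoose (β α : σ →₀ ℕ) : ℕ := ∏ i, (β i).choose (α i)

/-- After the binomial theorem in each factor, only the exponent choice `α` contributes to `t^α`,
and it is available exactly when `α ≤ β`. -/
theorem coeff_prod_C_add_X_pow {R : Type*} [CommRing R] (x : σ → R) (α β : σ →₀ ℕ) :
    coeff α (∏ i, (C (x i) + X i) ^ β i) =
      (multiChoose β α : R) * coordMonomial x (β - α) := by
  classical
  have h1 : ∀ i, (C (x i) + X i : MvPowerSeries σ R) ^ β i = ∑ j ∈ Finset.range (β i + 1),
      C (x i ^ (β i - j) * ((β i).choose j : R)) * X i ^ j := by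
    intro i
    rw [add_comm, add_pow]
    refine Finset.sum_congr rfl fun j _ => ?_
    rw [map_mul, map_pow, map_natCast]
    ring
  have h2 : ∀ g : σ → ℕ, ∏ i, (X i : MvPowerSeries σ R) ^ g i =
      monomial (Finsupp.equivFunOnFinite.symm g) 1 := by
    intro g
    rw [monomial_one_eq, Finsupp.prod_fintype _ _ (by simp)]
    rfl
  simp only [h1]
  rw [Finset.prod_univ_sum, map_sum]
  simp only [Finset.prod_mul_distrib, h2, ← map_prod, coeff_C_mul, coeff_monomial]
  rw [multiChoose, coordMonomial]
  by_cases hα : ∀ i, α i ≤ β i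
  · rw [Finset.sum_eq_single (⇑α)]
    · rw [if_pos (by ext; rfl)]
      simp only [mul_one]
      rw [mul_comm]
      push_cast
      rfl
    · intro g _ hg
      rw [if_neg, mul_zero]
      rintro rfl
      exact hg rfl
    · intro h
      exact absurd (Fintype.mem_piFinset.mpr fun i => Finset.mem_range.mpr
        (Nat.lt_succ_of_le (hα i))) h
  · push Not at hα
    obtain ⟨i, hi⟩ := hα
    rw [Finset.prod_eq_zero (Finset.mem_univ i) (Nat.choose_eq_zero_of_lt hi), Nat.cast_zero,
      zero_mul]
    refine Finset.sum_eq_zero fun g hg => ?_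
    rw [if_neg, mul_zero]
    rintro rfl
    have := Finset.mem_range.mp (Fintype.mem_piFinset.mp hg i)
    exact absurd hi (Nat.not_lt.mpr (Nat.le_of_lt_succ this))

theorem taylorOp_coordMonomial {T : S →ₐ[k] MvPowerSeries σ S} {x : σ → S}
    (hx : ∀ i, T (x i) = C (x i) + X i) (α β : σ →₀ ℕ) :
    taylorOp T α (coordMonomial x β) =
      (multiChoose β α : S) * coordMonomial x (β - α) := by
  rw [taylorOp_apply, ← coeff_prod_C_add_X_pow, coordMonomial, map_prod]
  simp only [map_pow, hx]

end TaylorOp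

/-! ### Identities for products of binomial coefficients. -/

section MultiChoose

variable {σ : Type*} [Fintype σ]

theorem multiChoose_mul (α β γ : σ →₀ ℕ) :
    multiChoose γ β * multiChoose (γ - β) α =
      multiChoose (α + β) β * multiChoose γ (α + β) := by
  simp only [multiChoose, ← Finset.prod_mul_distrib]
  refine Finset.prod_congr rfl fun i _ => ?_
  simp only [Finsupp.tsub_apply, Finsupp.add_apply]
  rw [mul_comm ((α i + β i).choose _), Nat.choose_mul (Nat.le_add_left _ _), Nat.add_sub_cancel]

theorem multiChoose_add_comm (α β : σ →₀ ℕ) :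
    multiChoose (α + β) β = multiChoose (α + β) α :=
  Finset.prod_congr rfl fun _ _ => Nat.choose_symm_add.symm

/-- The sum factors over the coordinates into alternating sums of binomial rows, each zero unless `ζ
i = 0`. -/
theorem sum_antidiagonal_neg_one_pow_mul_multiChoose [DecidableEq σ] (ζ : σ →₀ ℕ) :
    ∑ p ∈ Finset.HasAntidiagonal.antidiagonal ζ, (-1 : ℤ) ^ p.1.degree * multiChoose ζ p.1 =
      if ζ = 0 then 1 else 0 := by
  have h1 : ∑ p ∈ Finset.HasAntidiagonal.antidiagonal ζ, (-1 : ℤ) ^ p.1.degree * multiChoose ζ p.1 =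
      ∑ g ∈ Fintype.piFinset fun i => Finset.range (ζ i + 1),
        ∏ i, ((-1 : ℤ) ^ g i * (ζ i).choose (g i)) := by
    refine Finset.sum_bij' (fun p _ => ⇑p.1)
      (fun g _ => (Finsupp.equivFunOnFinite.symm g, ζ - Finsupp.equivFunOnFinite.symm g))
      ?_ ?_ ?_ ?_ ?_
    · rintro p hp
      rw [Finset.HasAntidiagonal.mem_antidiagonal] at hp
      simp only [Fintype.mem_piFinset, Finset.mem_range]
      intro i
      rw [← hp, Finsupp.add_apply]
      omega
    · intro g hg
      simp only [Fintype.mem_piFinset, Finset.mem_range] at hg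
      rw [Finset.HasAntidiagonal.mem_antidiagonal]
      exact add_tsub_cancel_of_le fun i => Nat.le_of_lt_succ (hg i)
    · rintro ⟨p, q⟩ hp
      rw [Finset.HasAntidiagonal.mem_antidiagonal] at hp
      have : Finsupp.equivFunOnFinite.symm (⇑p) = p := by ext; rfl
      simp [this, ← hp]
    · intro g _
      rfl
    · rintro p _
      rw [Finset.prod_mul_distrib, Finset.prod_pow_eq_pow_sum, Finsupp.degree_eq_sum, multiChoose]
      push_cast
      rfl
  rw [h1, ← Finset.prod_univ_sum (fun i => Finset.range (ζ i + 1))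
    fun i j => (-1 : ℤ) ^ j * (ζ i).choose j]
  simp only [Int.alternating_sum_range_choose]
  split_ifs with h
  · simp [h]
  · obtain ⟨i, hi⟩ := Finsupp.ne_iff.mp h
    exact Finset.prod_eq_zero (Finset.mem_univ i) (if_neg hi)

end MultiChoose

/-! ### Leibniz, composition and reversed Leibniz rules. -/

section Adjoint

variable {k : Type u} {S : Type v} [CommRing k] [CommRing S] [Algebra k S] {σ : Type*}

open MvPowerSeries

theorem mulDiffOp_mul (f g : S) : mulDiffOp k (f * g) = mulDiffOp k f * mulDiffOp k g :=
  Subtype.ext (LinearMap.ext fun s => mul_assoc f g s)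

theorem mulDiffOp_add (f g : S) : mulDiffOp k (f + g) = mulDiffOp k f + mulDiffOp k g :=
  Subtype.ext (LinearMap.ext fun s => add_mul f g s)

theorem mulDiffOp_zero : mulDiffOp k (0 : S) = 0 :=
  Subtype.ext (LinearMap.ext fun s => zero_mul s)

theorem mulDiffOp_one : mulDiffOp k (1 : S) = 1 :=
  Subtype.ext (LinearMap.ext fun s => one_mul s)

theorem neg_one_zsmul_diffOps (ξ : diffOps k S) : (-1 : ℤ) • ξ = -ξ :=
  neg_one_zsmul (G := diffOps k S) ξ

theorem mulDiffOp_neg (f : S) : mulDiffOp k (-f) = -mulDiffOp k f :=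
  Subtype.ext (LinearMap.ext fun s => neg_mul f s)

theorem mulDiffOp_sum {ι : Type*} (s : Finset ι) (f : ι → S) :
    mulDiffOp k (∑ i ∈ s, f i) = ∑ i ∈ s, mulDiffOp k (f i) :=
  map_sum (⟨⟨mulDiffOp k, mulDiffOp_zero⟩, mulDiffOp_add⟩ : S →+ diffOps k S) f s

/-- The operator `taylorOp T α` as an element of the ring of differential operators. -/
noncomputable def taylorDiffOp (T : S →ₐ[k] MvPowerSeries σ S)
    (hT : ∀ s, constantCoeff (T s) = s) (α : σ →₀ ℕ) : diffOps k S :=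
  ⟨taylorOp T α, α.degree, taylorOp_mem_diffOpOrder hT _ α le_rfl⟩

variable {T : S →ₐ[k] MvPowerSeries σ S} {hT : ∀ s, constantCoeff (T s) = s}

theorem taylorDiffOp_zero : taylorDiffOp T hT 0 = 1 :=
  Subtype.ext (LinearMap.ext fun s => hT s)

/-- The Leibniz rule. -/
theorem taylorDiffOp_mul_mulDiffOp [DecidableEq σ] (α : σ →₀ ℕ) (f : S) :
    taylorDiffOp T hT α * mulDiffOp k f = ∑ p ∈ Finset.HasAntidiagonal.antidiagonal α,
      mulDiffOp k (taylorOp T p.1 f) * taylorDiffOp T hT p.2 := by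
  refine Subtype.ext (LinearMap.ext fun s => ?_)
  rw [AddSubmonoidClass.coe_finsetSum, LinearMap.sum_apply]
  exact taylorOp_mul T α f s

variable [Fintype σ] {x : σ → S}

/-- The composition rule. -/
theorem taylorDiffOp_mul
    (hspan : Submodule.span S (Set.range fun i => KaehlerDifferential.D k S (x i)) = ⊤)
    (hx : ∀ i, T (x i) = C (x i) + X i) (α β : σ →₀ ℕ) :
    taylorDiffOp T hT α * taylorDiffOp T hT β =
      multiChoose (α + β) α • taylorDiffOp T hT (α + β) := by
  refine diffOps_ext_coordMonomial hspan fun γ => ?_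
  change taylorOp T α (taylorOp T β (coordMonomial x γ)) =
    multiChoose (α + β) α • taylorOp T (α + β) (coordMonomial x γ)
  rw [taylorOp_coordMonomial hx, taylorOp_coordMonomial hx, ← nsmul_eq_mul, map_nsmul,
    taylorOp_coordMonomial hx, ← multiChoose_add_comm, ← nsmul_eq_mul, ← nsmul_eq_mul,
    smul_smul, smul_smul, multiChoose_mul, tsub_tsub, add_comm β α]

/-- By the composition rule every term is a multiple of `∂^[ζ] f`, and the coefficients form the
alternating sum above. -/
theorem sum_neg_one_pow_taylorOp_taylorOp [DecidableEq σ]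
    (hspan : Submodule.span S (Set.range fun i => KaehlerDifferential.D k S (x i)) = ⊤)
    (hT : ∀ s, constantCoeff (T s) = s)
    (hx : ∀ i, T (x i) = C (x i) + X i) (ζ : σ →₀ ℕ) (f : S) :
    ∑ p ∈ Finset.HasAntidiagonal.antidiagonal ζ,
      (-1 : ℤ) ^ p.1.degree • taylorOp T p.2 (taylorOp T p.1 f) = if ζ = 0 then f else 0 := by
  have h : ∀ p ∈ Finset.HasAntidiagonal.antidiagonal ζ,
      (-1 : ℤ) ^ p.1.degree • taylorOp T p.2 (taylorOp T p.1 f) =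
      ((-1 : ℤ) ^ p.1.degree * multiChoose ζ p.1) • taylorOp T ζ f := by
    intro p hp
    rw [Finset.HasAntidiagonal.mem_antidiagonal] at hp
    have e : taylorOp T p.2 (taylorOp T p.1 f) =
        multiChoose (p.2 + p.1) p.2 • taylorOp T (p.2 + p.1) f :=
      congr(($(taylorDiffOp_mul (hT := hT) hspan hx p.2 p.1) : Module.End k S) f)
    rw [e, ← multiChoose_add_comm, add_comm, hp, mul_smul, natCast_zsmul]
  rw [Finset.sum_congr rfl h, ← Finset.sum_smul, sum_antidiagonal_neg_one_pow_mul_multiChoose]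
  split_ifs with h0
  · rw [h0, one_smul, taylorOp_zero_apply hT]
  · rw [zero_smul]

/-- This is the Leibniz rule solved for `f ∂^[α]`. Expanding the right side and grouping by the
total derivative `ζ` falling on `f`, only `ζ = 0` survives. -/
theorem mulDiffOp_mul_taylorDiffOp [DecidableEq σ]
    (hspan : Submodule.span S (Set.range fun i => KaehlerDifferential.D k S (x i)) = ⊤)
    (hx : ∀ i, T (x i) = C (x i) + X i) (α : σ →₀ ℕ) (f : S) :
    mulDiffOp k f * taylorDiffOp T hT α = ∑ p ∈ Finset.HasAntidiagonal.antidiagonal α,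
      (-1 : ℤ) ^ p.1.degree • (taylorDiffOp T hT p.2 * mulDiffOp k (taylorOp T p.1 f)) := by
  have e : ∑ p ∈ Finset.HasAntidiagonal.antidiagonal α,
      (-1 : ℤ) ^ p.1.degree • (taylorDiffOp T hT p.2 * mulDiffOp k (taylorOp T p.1 f)) =
      ∑ p ∈ Finset.HasAntidiagonal.antidiagonal α,
        mulDiffOp k (∑ q ∈ Finset.HasAntidiagonal.antidiagonal p.1,
          (-1 : ℤ) ^ q.1.degree • taylorOp T q.2 (taylorOp T q.1 f)) * taylorDiffOp T hT p.2 := by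
    simp only [taylorDiffOp_mul_mulDiffOp, mulDiffOp_sum, Finset.smul_sum, Finset.sum_mul,
      Finset.sum_sigma']
    -- Both sides run over triples with `i + l + m = α`, bracketed as `i + (l + m)` and `(i + l) +
    -- m`.
    refine Finset.sum_nbij' (fun ⟨⟨i, _⟩, ⟨l, m⟩⟩ => ⟨(i + l, m), (i, l)⟩)
      (fun ⟨⟨_, j⟩, ⟨l, m⟩⟩ => ⟨(l, m + j), (m, j)⟩) ?_ ?_ ?_ ?_ ?_
    · rintro ⟨⟨i, j⟩, ⟨l, m⟩⟩ h
      simp only [Finset.mem_sigma, Finset.HasAntidiagonal.mem_antidiagonal] at h ⊢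
      obtain ⟨rfl, rfl⟩ := h
      exact ⟨add_assoc _ _ _, trivial⟩
    · rintro ⟨⟨i, j⟩, ⟨l, m⟩⟩ h
      simp only [Finset.mem_sigma, Finset.HasAntidiagonal.mem_antidiagonal] at h ⊢
      obtain ⟨rfl, rfl⟩ := h
      exact ⟨(add_assoc _ _ _).symm, trivial⟩
    · rintro ⟨⟨i, j⟩, ⟨l, m⟩⟩ h
      simp only [Finset.mem_sigma, Finset.HasAntidiagonal.mem_antidiagonal] at h
      obtain ⟨rfl, rfl⟩ := h
      rfl
    · rintro ⟨⟨i, j⟩, ⟨l, m⟩⟩ h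
      simp only [Finset.mem_sigma, Finset.HasAntidiagonal.mem_antidiagonal] at h
      obtain ⟨rfl, rfl⟩ := h
      rfl
    · rintro ⟨⟨i, j⟩, ⟨l, m⟩⟩ _
      rw [← smul_mul_assoc]
      congr 1
      rcases neg_one_pow_eq_or ℤ i.degree with h | h
      · simp only [h, one_smul]
      · simp only [h]
        rw [neg_one_zsmul_diffOps, neg_one_zsmul, mulDiffOp_neg]
  rw [e]
  simp only [sum_neg_one_pow_taylorOp_taylorOp hspan hT hx]
  rw [Finset.sum_eq_single (0, α)]
  · rw [if_pos rfl]
  · rintro p hp hp0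
    rw [if_neg, mulDiffOp_zero, zero_mul]
    intro h
    rw [Finset.HasAntidiagonal.mem_antidiagonal, h, zero_add] at hp
    exact hp0 (Prod.ext h hp)
  · simp

/-! ### The normal form `∑ f_α ∂^[α]` and the formal adjoint. -/

variable (T hT) in
/-- The operator `∑ f_α ∂^[α]` attached to a family of coefficients `f_α`. -/
noncomputable def normalOrder : ((σ →₀ ℕ) →₀ S) →+ diffOps k S :=
  Finsupp.liftAddHom fun α => (AddMonoidHom.mulRight (taylorDiffOp T hT α)).comp
    ⟨⟨mulDiffOp k, mulDiffOp_zero⟩, mulDiffOp_add⟩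

variable (T hT) in
/-- The operator `∑ (-1)^|α| ∂^[α] f_α` attached to a family of coefficients `f_α`. -/
noncomputable def adjointOrder : ((σ →₀ ℕ) →₀ S) →+ diffOps k S :=
  Finsupp.liftAddHom fun α =>
    (AddMonoidHom.mulLeft ((-1 : ℤ) ^ α.degree • taylorDiffOp T hT α)).comp
    ⟨⟨mulDiffOp k, mulDiffOp_zero⟩, mulDiffOp_add⟩

omit [Fintype σ] in
theorem normalOrder_single (α : σ →₀ ℕ) (f : S) :
    normalOrder T hT (Finsupp.single α f) = mulDiffOp k f * taylorDiffOp T hT α := by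
  rw [normalOrder, Finsupp.liftAddHom_apply_single]
  rfl

omit [Fintype σ] in
theorem adjointOrder_single (α : σ →₀ ℕ) (f : S) :
    adjointOrder T hT (Finsupp.single α f) =
      (-1 : ℤ) ^ α.degree • (taylorDiffOp T hT α * mulDiffOp k f) := by
  rw [adjointOrder, Finsupp.liftAddHom_apply_single, ← smul_mul_assoc]
  rfl

/-- Unitriangularity: `α ≤ β` with `β.degree ≤ α.degree` forces `α = β`. -/
theorem taylorOp_coordMonomial_of_degree_le [DecidableEq σ] (hx : ∀ i, T (x i) = C (x i) + X i)
    {α β : σ →₀ ℕ} (h : β.degree ≤ α.degree) :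
    taylorOp T α (coordMonomial x β) = if α = β then 1 else 0 := by
  rw [taylorOp_coordMonomial hx]
  split_ifs with hαβ
  · subst hαβ
    simp [multiChoose, coordMonomial_zero]
  · have h1 : ∃ i, β i < α i := by
      by_contra! hle
      have hle : α ≤ β := hle
      have h2 := map_add Finsupp.degree α (β - α)
      rw [add_tsub_cancel_of_le hle] at h2
      have h3 : (β - α).degree = 0 := by omega
      rw [Finsupp.degree_eq_zero_iff, tsub_eq_zero_iff_le] at h3
      exact hαβ (le_antisymm hle h3)
    obtain ⟨i, hi⟩ := h1
    rw [multiChoose, Finset.prod_eq_zero (Finset.mem_univ i) (Nat.choose_eq_zero_of_lt hi),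
      Nat.cast_zero, zero_mul]

omit [Fintype σ] in
theorem normalOrder_apply (u : (σ →₀ ℕ) →₀ S) (s : S) :
    (normalOrder T hT u : Module.End k S) s = u.sum fun α f => f * taylorOp T α s := by
  induction u using Finsupp.induction_linear with
  | zero => simp
  | add u v hu hv =>
    rw [Finsupp.sum_add_index' (by simp) (by simp [add_mul]), ← hu, ← hv, map_add]
    rfl
  | single α f =>
    rw [normalOrder_single, Finsupp.sum_single_index (by simp)]
    rfl

/-- On `x^α`, with `α` of least degree in the support, the operator takes the value `f_α`. -/
theorem normalOrder_injective (hx : ∀ i, T (x i) = C (x i) + X i) :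
    Function.Injective (normalOrder T hT) := by
  classical
  rw [injective_iff_map_eq_zero]
  intro u hu
  by_contra hne
  obtain ⟨α, hα, hmin⟩ := Finset.exists_min_image u.support Finsupp.degree
    (Finsupp.support_nonempty_iff.mpr hne)
  have h := normalOrder_apply (hT := hT) u (coordMonomial x α)
  rw [hu, Finsupp.sum, Finset.sum_eq_single α] at h
  · rw [taylorOp_coordMonomial_of_degree_le hx le_rfl, if_pos rfl, mul_one] at h
    exact Finsupp.mem_support_iff.mp hα h.symm
  · intro β hβ hne
    rw [taylorOp_coordMonomial_of_degree_le hx (hmin β hβ), if_neg hne, mul_zero]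
  · exact fun h => absurd hα h

theorem exists_normalOrder_apply_eq (hx : ∀ i, T (x i) = C (x i) + X i) (ξ : Module.End k S)
    (m : ℕ) : ∃ u : (σ →₀ ℕ) →₀ S,
      -- This says order at most `m - 1`, with the zero operator for `m = 0`.
      (∀ l, m ≤ l + 1 → (normalOrder T hT u : Module.End k S) ∈ diffOpOrder k S l) ∧
      ∀ β : σ →₀ ℕ, β.degree < m → (normalOrder T hT u : Module.End k S) (coordMonomial x β) =
        ξ (coordMonomial x β) := by
  classical
  induction m with
  | zero => exact ⟨0, fun l _ => by rw [map_zero]; exact Submodule.zero_mem _, by simp⟩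
  | succ m ih =>
    obtain ⟨u, hu, hu'⟩ := ih
    let s := (Finsupp.finite_of_degree_eq (σ := σ) m).toFinset
    -- The errors in degree `m`; by unitriangularity, adding `∑ c_α ∂^[α]` removes them without
    -- disturbing lower degrees.
    let c : (σ →₀ ℕ) → S := fun α =>
      ξ (coordMonomial x α) - (normalOrder T hT u : Module.End k S) (coordMonomial x α)
    have hs : ∀ α, α ∈ s ↔ α.degree = m := by simp [s]
    have e : (normalOrder T hT (u + ∑ α ∈ s, Finsupp.single α (c α)) : Module.End k S) =
        normalOrder T hT u + ∑ α ∈ s, LinearMap.mulLeft k (c α) * taylorOp T α := by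
      rw [map_add, map_sum]
      simp only [normalOrder_single]
      rw [AddMemClass.coe_add, AddSubmonoidClass.coe_finsetSum]
      rfl
    refine ⟨u + ∑ α ∈ s, Finsupp.single α (c α), fun l hl => ?_, fun β hβ => ?_⟩
    · rw [e]
      refine Submodule.add_mem _ (hu l (by omega)) (Submodule.sum_mem _ fun α hα => ?_)
      have := (hs α).mp hα
      exact mul_mem_diffOpOrder k S l 0 l (zero_add l) _ (mulLeft_mem_diffOpOrder_zero k S _) _
        (taylorOp_mem_diffOpOrder hT _ _ (by omega))
    · rw [e, LinearMap.add_apply, LinearMap.sum_apply]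
      have h : ∀ α ∈ s, (LinearMap.mulLeft k (c α) * taylorOp T α) (coordMonomial x β) =
          if α = β then c α else 0 := by
        intro α hα
        have := (hs α).mp hα
        rw [Module.End.mul_apply, taylorOp_coordMonomial_of_degree_le hx (by omega),
          LinearMap.mulLeft_apply, mul_ite, mul_one, mul_zero]
      rw [Finset.sum_congr rfl h, Finset.sum_ite_eq']
      split_ifs with hβs
      · exact add_sub_cancel _ _
      · rw [hs] at hβs
        rw [hu' β (by omega), add_zero]

/-- Every differential operator has the form `∑ f_α ∂^[α]`. -/
theorem normalOrder_surjective
    (hspan : Submodule.span S (Set.range fun i => KaehlerDifferential.D k S (x i)) = ⊤)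
    (hx : ∀ i, T (x i) = C (x i) + X i) : Function.Surjective (normalOrder T hT) := by
  rintro ⟨ξ, m, hξ⟩
  -- Taking `m + 1` gives agreement in all degrees up to `m`, enough to determine an operator of
  -- order at most `m`.
  obtain ⟨u, hu, hu'⟩ := exists_normalOrder_apply_eq (hT := hT) hx ξ (m + 1)
  refine ⟨u, Subtype.ext (sub_eq_zero.mp ?_)⟩
  refine eq_zero_of_forall_coordMonomial hspan m _ (Submodule.sub_mem _ (hu m le_rfl) hξ)
    fun β hβ => ?_
  exact sub_eq_zero.mpr (hu' β (by omega))

theorem diffOps_induction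
    (hspan : Submodule.span S (Set.range fun i => KaehlerDifferential.D k S (x i)) = ⊤)
    (hx : ∀ i, T (x i) = C (x i) + X i) {p : diffOps k S → Prop} (zero : p 0)
    (add : ∀ ξ η, p ξ → p η → p (ξ + η))
    (mul : ∀ f α, p (mulDiffOp k f * taylorDiffOp T hT α)) (ξ : diffOps k S) : p ξ := by
  obtain ⟨u, rfl⟩ := normalOrder_surjective (hT := hT) hspan hx ξ
  induction u using Finsupp.induction_linear with
  | zero => rwa [map_zero]
  | add u v hu hv => rw [map_add]; exact add _ _ hu hv
  | single α f => rw [normalOrder_single]; exact mul f α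

theorem exists_addHom_diffOps
    (hspan : Submodule.span S (Set.range fun i => KaehlerDifferential.D k S (x i)) = ⊤)
    (hx : ∀ i, T (x i) = C (x i) + X i) :
    ∃ φ : diffOps k S →+ diffOps k S, ∀ f α, φ (mulDiffOp k f * taylorDiffOp T hT α) =
      (-1 : ℤ) ^ α.degree • (taylorDiffOp T hT α * mulDiffOp k f) := by
  let e := AddEquiv.ofBijective (normalOrder T hT)
    ⟨normalOrder_injective hx, normalOrder_surjective hspan hx⟩
  refine ⟨(adjointOrder T hT).comp e.symm.toAddMonoidHom, fun f α => ?_⟩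
  have h : e.symm (mulDiffOp k f * taylorDiffOp T hT α) = Finsupp.single α f := by
    rw [AddEquiv.symm_apply_eq]
    exact (normalOrder_single α f).symm
  change adjointOrder T hT (e.symm _) = _
  rw [h, adjointOrder_single]

theorem neg_one_pow_zsmul_eq_mul (n : ℕ) (ξ : diffOps k S) :
    (-1 : ℤ) ^ n • ξ = (-1) ^ n * ξ := by
  have h : ((-1 : ℤ) ^ n • (ξ : Module.End k S)) = (-1) ^ n * (ξ : Module.End k S) := by
    simp [zsmul_eq_mul]
  exact Subtype.ext h

theorem neg_one_pow_zsmul_neg_one_pow_zsmul (n : ℕ) (ξ : diffOps k S) :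
    (-1 : ℤ) ^ n • (-1 : ℤ) ^ n • ξ = ξ := by
  rcases neg_one_pow_eq_or ℤ n with h | h
  · rw [h, one_smul, one_smul]
  · rw [h, neg_one_zsmul_diffOps, neg_one_zsmul_diffOps]
    exact neg_neg ξ

theorem map_neg_one_pow_zsmul (φ : diffOps k S →+ diffOps k S) (n : ℕ) (ξ : diffOps k S) :
    φ ((-1 : ℤ) ^ n • ξ) = (-1 : ℤ) ^ n • φ ξ := by
  rcases neg_one_pow_eq_or ℤ n with h | h
  · rw [h, one_smul, one_smul]
  · rw [h, neg_one_zsmul_diffOps, neg_one_zsmul_diffOps]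
    exact map_neg φ ξ

section

variable {φ : diffOps k S →+ diffOps k S}
  (hφ : ∀ f α, φ (mulDiffOp k f * taylorDiffOp T hT α) =
    (-1 : ℤ) ^ α.degree • (taylorDiffOp T hT α * mulDiffOp k f))

include hφ

/-- By biadditivity the factors may be taken to be `f ∂^[α]` and `g ∂^[β]`. The Leibniz rule moves
`g` left past `∂^[α]` in the product, the reversed rule moves it right in the product of the images,
and the sums agree termwise. -/
theorem formalAdjoint_mul
    (hspan : Submodule.span S (Set.range fun i => KaehlerDifferential.D k S (x i)) = ⊤)
    (hx : ∀ i, T (x i) = C (x i) + X i) (ξ η : diffOps k S) : φ (ξ * η) = φ η * φ ξ := by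
  classical
  induction ξ using diffOps_induction (hT := hT) hspan hx with
  | zero => simp
  | add ξ₁ ξ₂ h₁ h₂ => rw [add_mul, map_add, map_add, mul_add, h₁, h₂]
  | mul f α =>
  induction η using diffOps_induction (hT := hT) hspan hx with
  | zero => simp
  | add η₁ η₂ h₁ h₂ => rw [mul_add, map_add, map_add, add_mul, h₁, h₂]
  | mul g β =>
  have e1 : mulDiffOp k f * taylorDiffOp T hT α * (mulDiffOp k g * taylorDiffOp T hT β) =
      ∑ p ∈ Finset.HasAntidiagonal.antidiagonal α, multiChoose (β + p.2) β •
        (mulDiffOp k (f * taylorOp T p.1 g) * taylorDiffOp T hT (β + p.2)) := by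
    rw [mul_assoc, ← mul_assoc (taylorDiffOp T hT α), taylorDiffOp_mul_mulDiffOp, Finset.sum_mul,
      Finset.mul_sum]
    refine Finset.sum_congr rfl fun p _ => ?_
    rw [mul_assoc, taylorDiffOp_mul hspan hx, ← multiChoose_add_comm, add_comm p.2 β, mulDiffOp_mul,
      mul_smul_comm, mul_smul_comm, mul_assoc]
  rw [e1, map_sum, hφ, hφ, smul_mul_smul_comm, mul_assoc, ← mul_assoc (mulDiffOp k g),
    mulDiffOp_mul_taylorDiffOp hspan hx, Finset.sum_mul, Finset.mul_sum, Finset.smul_sum]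
  refine Finset.sum_congr rfl fun p hp => ?_
  rw [Finset.HasAntidiagonal.mem_antidiagonal] at hp
  rw [map_nsmul, hφ, smul_comm, ← smul_mul_assoc, ← taylorDiffOp_mul hspan hx, smul_mul_assoc,
    mul_smul_comm, smul_smul, mul_comm f, mulDiffOp_mul, mul_assoc, mul_assoc]
  congr 1
  rw [← hp, map_add, map_add, pow_add, pow_add]
  -- As `α = p.1 + p.2`, the sign of `p.1` occurs twice on one side and cancels.
  rcases neg_one_pow_eq_or ℤ p.1.degree with h | h <;> rw [h] <;> ring

omit [Fintype σ] in
theorem formalAdjoint_mulDiffOp (f : S) : φ (mulDiffOp k f) = mulDiffOp k f := by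
  simpa [taylorDiffOp_zero] using hφ f 0

omit [Fintype σ] in
theorem formalAdjoint_taylorDiffOp (α : σ →₀ ℕ) :
    φ (taylorDiffOp T hT α) = (-1 : ℤ) ^ α.degree • taylorDiffOp T hT α := by
  simpa [mulDiffOp_one] using hφ 1 α

theorem formalAdjoint_involutive
    (hspan : Submodule.span S (Set.range fun i => KaehlerDifferential.D k S (x i)) = ⊤)
    (hx : ∀ i, T (x i) = C (x i) + X i) : Function.Involutive φ := by
  intro ξ
  induction ξ using diffOps_induction (hT := hT) hspan hx with
  | zero => simp
  | add ξ₁ ξ₂ h₁ h₂ => rw [map_add, map_add, h₁, h₂]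
  | mul f α =>
    rw [hφ, map_neg_one_pow_zsmul, formalAdjoint_mul hφ hspan hx, formalAdjoint_mulDiffOp hφ,
      formalAdjoint_taylorDiffOp hφ, mul_smul_comm, neg_one_pow_zsmul_neg_one_pow_zsmul]

end

end Adjoint

/-! ### Divided power operators and the main theorem. -/

theorem taylorDiffOp_isDividedPowerOp {k : Type u} {S : Type v} [CommRing k] [CommRing S]
    [Algebra k S] {n : ℕ} {x : Fin n → S} {T : S →ₐ[k] MvPowerSeries (Fin n) S}
    {hT : ∀ s, MvPowerSeries.constantCoeff (T s) = s}
    (hx : ∀ i, T (x i) = MvPowerSeries.C (x i) + MvPowerSeries.X i) (α : Fin n → ℕ) :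
    IsDividedPowerOp x α (taylorDiffOp T hT (Finsupp.equivFunOnFinite.symm α)) := fun β =>
  taylorOp_coordMonomial hx (Finsupp.equivFunOnFinite.symm α) (Finsupp.equivFunOnFinite.symm β)

theorem IsDividedPowerOp.unique {k : Type u} {S : Type v} [CommRing k] [CommRing S]
    [Algebra k S] {n : ℕ} {x : Fin n → S}
    (hspan : Submodule.span S (Set.range fun i => KaehlerDifferential.D k S (x i)) = ⊤)
    {α : Fin n → ℕ} {ξ η : diffOps k S} (hξ : IsDividedPowerOp x α ξ)
    (hη : IsDividedPowerOp x α η) : ξ = η :=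
  diffOps_ext_coordMonomial hspan fun β => (hξ β).trans (hη β).symm

/-- Ring anti-automorphisms of `D_{S|k}` are ring isomorphisms onto the opposite ring. The first
conjunct says that the operators `∂^{[α]}` exist and are well defined. -/
theorem mainTheorem10 (k : Type u) (S : Type v) [CommRing k] [CommRing S] [Algebra k S]
    [Algebra.FormallySmooth k S] (hS : IsEssFinitePresentation k S)
    (n : ℕ) (x : Fin n → S)
    (hli : LinearIndependent S fun i => KaehlerDifferential.D k S (x i))
    (hspan : Submodule.span S (Set.range fun i => KaehlerDifferential.D k S (x i)) = ⊤) :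
    (∀ α : Fin n → ℕ, ∃! ξ : diffOps k S, IsDividedPowerOp x α ξ) ∧
    ∃! Φ : diffOps k S ≃+* (diffOps k S)ᵐᵒᵖ,
      (∀ ξ : diffOps k S, (Φ (Φ ξ).unop).unop = ξ) ∧
      (∀ f : S, (Φ (mulDiffOp k f)).unop = mulDiffOp k f) ∧
      (∀ (α : Fin n → ℕ) (ξ : diffOps k S), IsDividedPowerOp x α ξ →
        (Φ ξ).unop = (-1) ^ (∑ i, α i) * ξ) := by
  obtain ⟨T, hT, hx⟩ := exists_taylorHom x hli hspan
  obtain ⟨φ, hφ⟩ := exists_addHom_diffOps (hT := hT) hspan hx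
  have hinv := formalAdjoint_involutive hφ hspan hx
  refine ⟨fun α => ⟨_, taylorDiffOp_isDividedPowerOp (hT := hT) hx α, fun ξ hξ =>
    hξ.unique hspan (taylorDiffOp_isDividedPowerOp hx α)⟩, ?_⟩
  refine ⟨⟨⟨fun ξ => MulOpposite.op (φ ξ), fun ξ => φ ξ.unop, hinv,
    fun ξ => MulOpposite.unop_injective (hinv ξ.unop)⟩,
    fun ξ η => congrArg MulOpposite.op (formalAdjoint_mul hφ hspan hx ξ η),
    fun ξ η => congrArg MulOpposite.op (map_add φ ξ η)⟩,
    ⟨hinv, formalAdjoint_mulDiffOp hφ, fun α ξ hξ => ?_⟩, ?_⟩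
  · obtain rfl := hξ.unique hspan (taylorDiffOp_isDividedPowerOp (hT := hT) hx α)
    refine (formalAdjoint_taylorDiffOp hφ _).trans ?_
    rw [neg_one_pow_zsmul_eq_mul, Finsupp.degree_eq_sum]
    rfl
  -- The values on `f` and `∂^[α]` fix those on `f ∂^[α]`, and these products generate the ring
  -- additively.
  · rintro Ψ ⟨-, hΨ, hΨ'⟩
    refine RingEquiv.ext fun ξ => MulOpposite.unop_injective ?_
    change (Ψ ξ).unop = φ ξ
    induction ξ using diffOps_induction (hT := hT) hspan hx with
    | zero => simp
    | add ξ η h₁ h₂ => rw [map_add, map_add, MulOpposite.unop_add, h₁, h₂]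
    | mul f α =>
      have hα := hΨ' α _ (taylorDiffOp_isDividedPowerOp (hT := hT) hx α)
      rw [show Finsupp.equivFunOnFinite.symm (⇑α) = α from Finsupp.ext fun _ => rfl] at hα
      rw [map_mul, MulOpposite.unop_mul, hΨ, hα, hφ, neg_one_pow_zsmul_eq_mul,
        Finsupp.degree_eq_sum, mul_assoc]
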